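/- All spaces are locally compact and Hausdorff, sheaves are sheaves of abelian groups, and $\mathcal{SH}(Z)$ denotes the category of sheaves of abelian groups on $Z$. The support of a section $s\in\Gamma(U,\mathcal F)$ over an open set $U$ is $\operatorname{supp}(s)=\{x\in U\mid s_x\neq 0\}$. Let $\Gamma_c(X,\mathcal F)\subseteq\Gamma(X,\mathcal F)$ be the group of global sections with compact support, and let $H^i_c(X,-)$ be the $i$-th right derived functor of the left exact functor $\Gamma_c(X,-)$. For a continuous map $\varphi\colon X\to Y$ let $\varphi_!\colon\mathcal{SH}(X)\to\mathcal{SH}(Y)$ be the left exact functor with $$\Gamma(V,\varphi_!\mathcal F)=\{s\in\Gamma(\varphi^{-1}(V),\mathcal F)\mid \varphi|_{\operatorname{supp}(s)}\colon\operatorname{supp}(s)\to V\ \text{is proper}\}\qquad (V\subseteq Y\ \text{open}),$$ regarded as a subsheaf of $\varphi_*\mathcal F$, and let $R^i\varphi_!$ be its $i$-th right derived functor. Let $X,Y$ be locally compact Hausdorff spaces, $\varphi\colon X\to Y$ a continuous map, $\mathcal F\in\mathcal{SH}(X)$ and $q\ge 0$ an integer. If $R^i\varphi_!\mathcal F=0$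 for all $0\le i<q$, then $H^i_c(X,\mathcal F)=0$ for all $0\le i<q$, and there is an isomorphism of abelian groups $H^q_c(X,\mathcal F)\cong\Gamma_c(Y,R^q\varphi_!\mathcal F)$. -/

import Mathlib

open CategoryTheory TopologicalSpace Opposite TopCat Filter Topology

universe u

noncomputable section

namespace CompactSupport

/-! ### Supports of sections -/

section Support

variable {X : TopCat.{u}}

/-- The support `{x ∈ U | s_x ≠ 0}` of a section `s` over `U`, as a subset of `X`. -/
def supp (F : TopCat.Presheaf AddCommGrpCat.{u} X) {U : Opens X} (s : F.obj (op U)) : Set X :=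
  {x | ∃ h : x ∈ U, F.germ U x h s ≠ 0}

variable {F G : TopCat.Presheaf AddCommGrpCat.{u} X}

lemma mem_supp {U : Opens X} {s : F.obj (op U)} {x : X} (h : x ∈ U) :
    x ∈ supp F s ↔ F.germ U x h s ≠ 0 :=
  ⟨fun ⟨_, h'⟩ => h', fun h' => ⟨h, h'⟩⟩

lemma supp_subset {U : Opens X} (s : F.obj (op U)) : supp F s ⊆ U := fun _ h => h.1

lemma supp_zero {U : Opens X} : supp F (0 : F.obj (op U)) = ∅ := by
  ext x
  simp [supp]

lemma supp_neg {U : Opens X} (s : F.obj (op U)) : supp F (-s) = supp F s := by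
  ext x
  simp [supp]

lemma supp_add {U : Opens X} (s t : F.obj (op U)) :
    supp F (s + t) ⊆ supp F s ∪ supp F t := by
  rintro x ⟨h, hx⟩
  by_contra hc
  simp only [Set.mem_union, not_or, mem_supp h, not_not] at hc
  exact hx (by rw [map_add, hc.1, hc.2, add_zero])

lemma supp_res {U W : Opens X} (i : W ⟶ U) (s : F.obj (op U)) :
    supp F (F.map i.op s) = supp F s ∩ W := by
  ext x
  constructor
  · rintro ⟨h, hx⟩
    exact ⟨⟨i.le h, by rwa [TopCat.Presheaf.germ_res_apply] at hx⟩, h⟩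
  · rintro ⟨⟨h, hx⟩, hW⟩
    exact ⟨hW, by rwa [TopCat.Presheaf.germ_res_apply]⟩

lemma supp_map {U : Opens X} (α : F ⟶ G) (s : F.obj (op U)) :
    supp G (α.app (op U) s) ⊆ supp F s := by
  rintro x ⟨h, hx⟩
  refine ⟨h, fun h0 => hx ?_⟩
  rw [← TopCat.Presheaf.stalkFunctor_map_germ_apply, h0]
  exact map_zero ((TopCat.Presheaf.stalkFunctor AddCommGrpCat x).map α).hom

/-- The support of a section over `U` is relatively closed in `U`. -/
lemma exists_open_of_notMem_supp {U : Opens X} (s : F.obj (op U)) {x : X} (hx : x ∈ U)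
    (h : x ∉ supp F s) : ∃ W : Opens X, x ∈ W ∧ ∀ y ∈ W, y ∉ supp F s := by
  rw [mem_supp hx, not_not, ← map_zero (F.germ U x hx).hom] at h
  obtain ⟨W, hxW, i, j, hij⟩ := F.germ_eq x hx hx s 0 h
  refine ⟨W, hxW, fun y hy hys => ?_⟩
  rw [map_zero] at hij
  have h2 : y ∈ supp F (F.map i.op s) := by rw [supp_res]; exact ⟨hys, hy⟩
  rw [hij, supp_zero] at h2
  exact h2

lemma mem_supp_of_le_nhds {U : Opens X} (s : F.obj (op U)) {x : X} (hx : x ∈ U)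
    {l : Filter X} [l.NeBot] (hl : l ≤ 𝓝 x) (hs : supp F s ∈ l) : x ∈ supp F s := by
  by_contra h
  obtain ⟨W, hxW, hW⟩ := exists_open_of_notMem_supp s hx h
  obtain ⟨y, hy⟩ := l.nonempty_of_mem (inter_mem hs (hl (W.isOpen.mem_nhds hxW)))
  exact hW y hy.2 hy.1

/-- A global section whose support lies in a compact set has compact support. -/
lemma isCompact_supp_of_subset {s : F.obj (op ⊤)} {K : Set X} (hK : IsCompact K)
    (h : supp F s ⊆ K) : IsCompact (supp F s) := by
  refine hK.of_isClosed_subset ?_ h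
  rw [isClosed_iff_forall_filter]
  exact fun x l _ hs hl => mem_supp_of_le_nhds s trivial hl (le_principal_iff.1 hs)

end Support

/-! ### Global sections with compact support -/

section Gamma

variable (X : TopCat.{u})

/-- The group `{s ∈ Γ(X, F) | supp s is compact}`. -/
def compactSections {X : TopCat.{u}} (F : TopCat.Sheaf AddCommGrpCat.{u} X) :
    AddSubgroup (F.obj.obj (op ⊤)) where
  carrier := {s | IsCompact (supp F.obj s)}
  zero_mem' := by
    change IsCompact (supp F.obj 0)
    rw [supp_zero]
    exact isCompact_empty
  add_mem' {s t} hs ht :=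
    isCompact_supp_of_subset (IsCompact.union hs ht) (supp_add s t)
  neg_mem' {s} hs := by
    change IsCompact (supp F.obj (-s))
    rwa [supp_neg]

/-- The functor `Γ_c(X, -)` of global sections with compact support. -/
def gammaC : TopCat.Sheaf AddCommGrpCat.{u} X ⥤ AddCommGrpCat.{u} where
  obj F := AddCommGrpCat.of (compactSections F)
  map {F G} α := AddCommGrpCat.ofHom
    (((α.hom.app (op ⊤)).hom.comp (compactSections F).subtype).codRestrict (compactSections G)
      fun s => isCompact_supp_of_subset s.2 (supp_map α.hom s.1))

instance : (gammaC X).Additive where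

/-- Cohomology with compact supports `H^i_c(X, -)`: the `i`-th right derived functor of
`Γ_c(X, -)`. -/
def Hc (i : ℕ) : TopCat.Sheaf AddCommGrpCat.{u} X ⥤ AddCommGrpCat.{u} :=
  (gammaC X).rightDerived i

end Gamma

/-! ### Direct image with compact supports -/

/-- For `p : A → B`, `S ⊆ A` and `V ⊆ B`: one has `p(S) ⊆ V` and the induced map `S → V` is
proper. -/
def ProperOver {A B : Type*} [TopologicalSpace A] [TopologicalSpace B] (p : A → B) (S : Set A)
    (V : Set B) : Prop :=
  ∃ h : Set.MapsTo p S V, IsProperMap (h.restrict p S V)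

lemma properOver_iff {A B : Type*} [TopologicalSpace A] [TopologicalSpace B] {p : A → B}
    (hp : Continuous p) {S : Set A} {V : Set B} :
    ProperOver p S V ↔ Set.MapsTo p S V ∧ ∀ (l : Ultrafilter A) (y : B), y ∈ V → S ∈ l →
      Tendsto p l (𝓝 y) → ∃ x ∈ S, p x = y ∧ (l : Filter A) ≤ 𝓝 x := by
  rw [ProperOver, ← exists_prop]
  refine exists_congr fun h => ?_
  rw [isProperMap_iff_ultrafilter]
  constructor
  · rintro ⟨-, H⟩ l y hy hS hl
    have hr : Set.range (Subtype.val : S → A) ∈ l := by rwa [Subtype.range_coe]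
    have hmap : Filter.map Subtype.val
        (l.comap Subtype.val_injective hr : Filter S) = (l : Filter A) := by
      rw [Ultrafilter.coe_comap, Filter.map_comap_of_mem hr]
    obtain ⟨x, hx, hle⟩ := H (𝒰 := l.comap Subtype.val_injective hr) (y := ⟨y, hy⟩) (by
      rw [tendsto_subtype_rng]
      have : Tendsto (p ∘ Subtype.val) (l.comap Subtype.val_injective hr : Filter S) (𝓝 y) := by
        rw [← tendsto_map'_iff, hmap]
        exact hl
      exact this)
    refine ⟨x, x.2, congrArg Subtype.val hx, ?_⟩
    rw [← hmap]
    exact (Filter.map_mono hle).trans (continuous_subtype_val.tendsto x)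
  · intro H
    refine ⟨hp.restrict h, fun {l} y hl => ?_⟩
    obtain ⟨x, hxS, hx, hle⟩ := H (l.map Subtype.val) y y.2
      (by
        rw [Ultrafilter.mem_map]
        exact Filter.univ_mem' fun a => a.2)
      (by
        rw [tendsto_subtype_rng] at hl
        exact hl)
    refine ⟨⟨x, hxS⟩, Subtype.ext hx, ?_⟩
    rw [nhds_subtype_eq_comap]
    exact Filter.map_le_iff_le_comap.1 hle

section LowerShriek

variable {X Y : TopCat.{u}} (f : X ⟶ Y)

lemma properOver_supp_of_subset {F : TopCat.Presheaf AddCommGrpCat.{u} X} {V : Opens Y}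
    {s : F.obj (op ((Opens.map f).obj V))} {T : Set X}
    (hT : Set.MapsTo f T V ∧ ∀ (l : Ultrafilter X) (y : Y), y ∈ (V : Set Y) → T ∈ l →
      Tendsto f l (𝓝 y) → ∃ x ∈ T, f x = y ∧ (l : Filter X) ≤ 𝓝 x)
    (h : supp F s ⊆ T) : ProperOver f (supp F s) (V : Set Y) := by
  rw [properOver_iff f.hom.continuous]
  refine ⟨hT.1.mono_left h, fun l y hy hS hl => ?_⟩
  obtain ⟨x, hxT, hx, hle⟩ := hT.2 l y hy (mem_of_superset hS h) hl
  exact ⟨x, mem_supp_of_le_nhds s (hT.1 hxT) hle hS, hx, hle⟩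

/-- The group of those sections `s ∈ Γ(f⁻¹(V), F)` whose support is proper over `V`. -/
def properSections (F : TopCat.Presheaf AddCommGrpCat.{u} X) (V : Opens Y) :
    AddSubgroup (F.obj (op ((Opens.map f).obj V))) where
  carrier := {s | ProperOver f (supp F s) (V : Set Y)}
  zero_mem' := by
    change ProperOver f (supp F 0) (V : Set Y)
    rw [supp_zero, properOver_iff f.hom.continuous]
    exact ⟨Set.mapsTo_empty _ _, fun l y _ h => absurd h l.empty_notMem⟩
  add_mem' {s t} hs ht := by
    change ProperOver f _ (V : Set Y) at hs ht
    rw [properOver_iff f.hom.continuous] at hs ht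
    refine properOver_supp_of_subset f (T := supp F s ∪ supp F t)
      ⟨hs.1.union ht.1, fun l y hy hST hl => ?_⟩ (supp_add s t)
    rcases Ultrafilter.union_mem_iff.1 hST with h | h
    · obtain ⟨x, hx, h'⟩ := hs.2 l y hy h hl
      exact ⟨x, Or.inl hx, h'⟩
    · obtain ⟨x, hx, h'⟩ := ht.2 l y hy h hl
      exact ⟨x, Or.inr hx, h'⟩
  neg_mem' {s} hs := by
    change ProperOver f (supp F (-s)) (V : Set Y)
    rwa [supp_neg]

lemma mem_properSections {F : TopCat.Presheaf AddCommGrpCat.{u} X} {V : Opens Y}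
    {s : F.obj (op ((Opens.map f).obj V))} :
    s ∈ properSections f F V ↔ ProperOver f (supp F s) (V : Set Y) := Iff.rfl

lemma res_mem_properSections {F : TopCat.Presheaf AddCommGrpCat.{u} X} {V W : Opens Y}
    (i : W ⟶ V) {s : F.obj (op ((Opens.map f).obj V))} (hs : s ∈ properSections f F V) :
    F.map ((Opens.map f).map i).op s ∈ properSections f F W := by
  rw [mem_properSections, properOver_iff f.hom.continuous] at hs ⊢
  rw [supp_res]
  refine ⟨fun x hx => hx.2, fun l y hy hS hl => ?_⟩
  obtain ⟨x, hxS, hx, hle⟩ := hs.2 l y (i.le hy) (mem_of_superset hS Set.inter_subset_left) hl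
  refine ⟨x, ⟨hxS, ?_⟩, hx, hle⟩
  change f x ∈ W
  rw [hx]
  exact hy

/-- The subpresheaf `f_! F` of `f_* F`. -/
def shriekPresheaf (F : TopCat.Presheaf AddCommGrpCat.{u} X) :
    TopCat.Presheaf AddCommGrpCat.{u} Y where
  obj V := AddCommGrpCat.of (properSections f F V.unop)
  map {V W} i := AddCommGrpCat.ofHom
    (((F.map ((Opens.map f).map i.unop).op).hom.comp (properSections f F V.unop).subtype).codRestrict
      (properSections f F W.unop) fun s => res_mem_properSections f i.unop s.2)
  map_id V := by
    ext s
    change F.map (𝟙 _) s.1 = s.1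
    simp
  map_comp {U V W} i j := by
    ext s
    change F.map (((Opens.map f).map i.unop).op ≫ ((Opens.map f).map j.unop).op) s.1 = _
    rw [F.map_comp]
    rfl

/-- A section over `f⁻¹(⋃ Vₖ)` belongs to `f_! F` as soon as its restrictions do. -/
lemma mem_properSections_of_cover {F : TopCat.Presheaf AddCommGrpCat.{u} X} {ι : Type*}
    (V : ι → Opens Y) (s : F.obj (op ((Opens.map f).obj (iSup V))))
    (h : ∀ k, F.map ((Opens.map f).map (Opens.leSupr V k)).op s ∈ properSections f F (V k)) :
    s ∈ properSections f F (iSup V) := by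
  rw [mem_properSections, properOver_iff f.hom.continuous]
  refine ⟨fun x hx => supp_subset s hx, fun l y hy hS hl => ?_⟩
  obtain ⟨k, hk⟩ := Opens.mem_iSup.1 hy
  have hsk := h k
  rw [mem_properSections, properOver_iff f.hom.continuous, supp_res] at hsk
  obtain ⟨x, hxS, hx⟩ := hsk.2 l y hk
    (inter_mem hS (hl ((V k).isOpen.mem_nhds hk))) hl
  exact ⟨x, hxS.1, hx⟩

lemma shriekPresheaf_isSheaf (F : TopCat.Sheaf AddCommGrpCat.{u} X) :
    (shriekPresheaf f F.obj).IsSheaf := by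
  rw [TopCat.Presheaf.isSheaf_iff_isSheafUniqueGluing]
  intro ι V sf hsf
  have hG := ((TopCat.Sheaf.pushforward AddCommGrpCat.{u} f).obj F).existsUnique_gluing V
    (fun k => (sf k).1) (fun i j => congrArg Subtype.val (hsf i j))
  obtain ⟨s, hs, huniq⟩ := hG
  refine ⟨⟨s, mem_properSections_of_cover f V s fun k => ?_⟩, fun k => Subtype.ext (hs k),
    fun t ht => Subtype.ext (huniq t.1 fun k => congrArg Subtype.val (ht k))⟩
  exact (congrArg (· ∈ properSections f F.obj (V k)) (hs k)).mpr (sf k).2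

/-- The direct image with compact supports `f_! : SH(X) ⥤ SH(Y)`. -/
def lowerShriek : TopCat.Sheaf AddCommGrpCat.{u} X ⥤ TopCat.Sheaf AddCommGrpCat.{u} Y where
  obj F := ⟨shriekPresheaf f F.obj, shriekPresheaf_isSheaf f F⟩
  map {F G} α := ⟨{
    app := fun V => AddCommGrpCat.ofHom
      (((α.hom.app (op ((Opens.map f).obj V.unop))).hom.comp
        (properSections f F.obj V.unop).subtype).codRestrict (properSections f G.obj V.unop)
        fun s => properSections_map α s)
    naturality := fun V W i => by
      ext s
      apply Subtype.ext
      exact ConcreteCategory.congr_hom (α.hom.naturality ((Opens.map f).map i.unop).op) s.1 }⟩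
where
  properSections_map {F G : TopCat.Sheaf AddCommGrpCat.{u} X} (α : F ⟶ G) {V : Opens Y}
      (s : properSections f F.obj V) :
      α.hom.app (op ((Opens.map f).obj V)) s.1 ∈ properSections f G.obj V :=
    properOver_supp_of_subset f ((properOver_iff f.hom.continuous).1 s.2) (supp_map α.hom s.1)

instance : (lowerShriek f).Additive where

/-- The higher direct images with compact supports `R^i f_!`: the `i`-th right derived functor of
`f_!`. -/
def RShriek (i : ℕ) : TopCat.Sheaf AddCommGrpCat.{u} X ⥤ TopCat.Sheaf AddCommGrpCat.{u} Y :=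
  (lowerShriek f).rightDerived i

end LowerShriek

end CompactSupport

end

/-! Let `I` be an injective resolution of `F` and `K = φ_! I`, so that `R^i φ_! F` is the homology
of `K`. Properness over `Y` gives `Γ_c(Y, φ_! -) = Γ_c(X, -)`, so `H^i_c(X, F)` is the homology of
`Γ_c(Y, K)`. It remains to see that `Γ_c(Y, -)` commutes with the homology of `K` up to degree `q`.

Injective sheaves are flasque, and `φ_!` of a flasque sheaf is c-soft (`isCSoft_lowerShriek`). A
short exact sequence with c-soft kernel stays exact under `Γ_c` (`gammaC_map_g_surjective`), and a
quotient of a c-soft sheaf by a c-soft subsheaf is c-soft. Since `K` is exact below `q`, induction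
through `0 → Z^i → K^i → B^(i+1) → 0` with `Z^i = B^i` for `i < q` shows that `B^i` is c-soft and
that `Γ_c(K^(i-1)) → Γ_c(B^i)` is onto for `0 < i ≤ q`. Finally `0 → B^i → Z^i → H^i → 0` identifies
`Γ_c(H^i)` with the homology of `Γ_c(K)`. -/

noncomputable section

namespace CompactSupport

/-! ### Restriction, gluing and supports -/

section Restriction

variable {X : TopCat.{u}}

/-- Restriction of sections along an inclusion of open sets. -/
def res (F : TopCat.Presheaf AddCommGrpCat.{u} X) {U V : Opens X} (h : V ≤ U) :
    F.obj (op U) →+ F.obj (op V) :=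
  (F.map (homOfLE h).op).hom

section Presheaf

variable {F G : TopCat.Presheaf AddCommGrpCat.{u} X}

@[simp]
lemma res_res {U V W : Opens X} (h : V ≤ U) (h' : W ≤ V) (s : F.obj (op U)) :
    res F h' (res F h s) = res F (h'.trans h) s := by
  change (F.map (homOfLE h).op ≫ F.map (homOfLE h').op) s = _
  rw [← F.map_comp]
  rfl

lemma app_res (α : F ⟶ G) {U V : Opens X} (h : V ≤ U) (s : F.obj (op U)) :
    α.app (op V) (res F h s) = res G h (α.app (op U) s) :=
  ConcreteCategory.congr_hom (α.naturality (homOfLE h).op) s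

lemma supp_res_le {U V : Opens X} (h : V ≤ U) (s : F.obj (op U)) :
    supp F (res F h s) = supp F s ∩ V :=
  supp_res (homOfLE h) s

end Presheaf

variable (F : TopCat.Sheaf AddCommGrpCat.{u} X)

variable {F} in
/-- Two sections which agree on the overlap glue. -/
lemma exists_glue {U V W : Opens X} (hU : U ≤ W) (hV : V ≤ W) (hW : W ≤ U ⊔ V)
    (s : F.obj.obj (op U)) (t : F.obj.obj (op V))
    (h : res F.obj (inf_le_left : U ⊓ V ≤ U) s = res F.obj inf_le_right t) :
    ∃ r : F.obj.obj (op W), res F.obj hU r = s ∧ res F.obj hV r = t := by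
  let O : Bool → Opens X := fun b => bif b then U else V
  let sf : ∀ b, F.obj.obj (op (O b)) := fun b => match b with
    | true => s
    | false => t
  obtain ⟨r, hr, -⟩ := F.existsUnique_gluing' O W
    (fun b => homOfLE (match b with
      | true => hU
      | false => hV)) (by rwa [iSup_bool_eq]) sf (by
    rintro (_ | _) (_ | _)
    · rfl
    · have := congrArg (res F.obj (inf_comm V U).le) h
      rw [res_res, res_res] at this
      exact this.symm
    · exact h
    · rfl)
  exact ⟨r, hr true, hr false⟩

variable {F} in
lemma eq_of_res_eq {U V W : Opens X} (hU : U ≤ W) (hV : V ≤ W) (hW : W ≤ U ⊔ V)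
    {s t : F.obj.obj (op W)} (h₁ : res F.obj hU s = res F.obj hU t)
    (h₂ : res F.obj hV s = res F.obj hV t) : s = t :=
  F.eq_of_locally_eq₂ (homOfLE hU) (homOfLE hV) hW s t h₁ h₂

variable {F} in
/-- A section with empty support vanishes. -/
lemma eq_zero_of_supp_eq_empty {U : Opens X} {s : F.obj.obj (op U)} (h : supp F.obj s = ∅) :
    s = 0 := by
  refine TopCat.Presheaf.section_ext F U s 0 fun x hx => ?_
  rw [map_zero]
  by_contra h0
  exact (Set.eq_empty_iff_forall_notMem.1 h x) ⟨hx, h0⟩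

variable {F} in
lemma res_eq_zero_of_disjoint {U V : Opens X} (hV : V ≤ U) {s : F.obj.obj (op U)}
    (h : ∀ x ∈ V, x ∉ supp F.obj s) : res F.obj hV s = 0 := by
  refine eq_zero_of_supp_eq_empty ?_
  rw [supp_res_le]
  exact Set.eq_empty_iff_forall_notMem.2 fun x hx => h x hx.2 hx.1

lemma notMem_supp_of_res_eq_zero {F : TopCat.Presheaf AddCommGrpCat.{u} X} {U V : Opens X}
    (hV : V ≤ U) {s : F.obj (op U)} (h : res F hV s = 0) {x : X} (hx : x ∈ V) :
    x ∉ supp F s := by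
  intro hs
  have : x ∈ supp F (res F hV s) := by
    rw [supp_res_le]
    exact ⟨hs, hx⟩
  rw [h, supp_zero] at this
  exact this

end Restriction

/-! ### c-soft sheaves and the exactness of `Γ_c` -/

section CSoft

variable {X : TopCat.{u}}

/-- A sheaf is c-soft if every section on a neighbourhood of a compact set `K` agrees near `K` with
a global section of compact support. -/
def IsCSoft (F : TopCat.Sheaf AddCommGrpCat.{u} X) : Prop :=
  ∀ ⦃K : Set X⦄ ⦃U : Opens X⦄, IsCompact K → K ⊆ U → ∀ s : F.obj.obj (op U),
    ∃ t : F.obj.obj (op ⊤), IsCompact (supp F.obj t) ∧ ∃ (W : Opens X) (hW : W ≤ U), K ⊆ W ∧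
      res F.obj le_top t = res F.obj hW s

lemma IsCSoft.of_iso {F G : TopCat.Sheaf AddCommGrpCat.{u} X} (e : F ≅ G) (hF : IsCSoft F) :
    IsCSoft G := by
  intro K U hK hKU s
  obtain ⟨t, ht, W, hW, hKW, h⟩ := hF hK hKU (e.inv.hom.app (op U) s)
  refine ⟨e.hom.hom.app (op ⊤) t, isCompact_supp_of_subset ht (supp_map e.hom.hom t), W, hW, hKW, ?_⟩
  rw [← app_res, h, app_res]
  congr 1
  have : e.inv.hom ≫ e.hom.hom = 𝟙 _ := congrArg (fun f => f.hom) e.inv_hom_id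
  exact ConcreteCategory.congr_hom (congrArg (fun f => f.app (op U)) this) s

lemma subsingleton_of_isZero {F : TopCat.Sheaf AddCommGrpCat.{u} X} (hF : Limits.IsZero F)
    (U : Opens X) : Subsingleton (F.obj.obj (op U)) := by
  have h : (𝟙 F : F ⟶ F) = 0 := hF.eq_of_src _ _
  refine subsingleton_of_forall_eq 0 fun s => ?_
  exact ConcreteCategory.congr_hom (congrArg (fun f => f.hom.app (op U)) h) s

lemma IsCSoft.of_isZero {F : TopCat.Sheaf AddCommGrpCat.{u} X} (hF : Limits.IsZero F) :
    IsCSoft F := by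
  intro K U _ hKU s
  refine ⟨0, ?_, U, le_rfl, hKU, (subsingleton_of_isZero hF U).elim _ _⟩
  rw [supp_zero]
  exact isCompact_empty

section ShortExact

variable {S : ShortComplex (TopCat.Sheaf AddCommGrpCat.{u} X)} (hS : S.ShortExact)

lemma g_app_f_app (S : ShortComplex (TopCat.Sheaf AddCommGrpCat.{u} X)) {U : Opens X}
    (a : S.X₁.obj.obj (op U)) : S.g.hom.app (op U) (S.f.hom.app (op U) a) = 0 :=
  ConcreteCategory.congr_hom (congrArg (fun f => f.hom.app (op U)) S.zero) a

include hS

lemma exists_preimage_of_g_app_eq_zero {U : Opens X} {b : S.X₂.obj.obj (op U)}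
    (hb : S.g.hom.app (op U) b = 0) : ∃ a : S.X₁.obj.obj (op U), S.f.hom.app (op U) a = b :=
  TopCat.Sheaf.sections_exact_of_left_exact hS.exact hS.mono_f b hb

lemma exists_local_lift {U : Opens X} (c : S.X₃.obj.obj (op U)) {x : X} (hx : x ∈ U) :
    ∃ (V : Opens X) (hV : V ≤ U) (b : S.X₂.obj.obj (op V)), x ∈ V ∧
      S.g.hom.app (op V) b = res S.X₃.obj hV c := by
  obtain ⟨V, hV, ⟨b, hb⟩, hxV⟩ := (TopCat.Presheaf.isLocallySurjective_iff S.g.hom).1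
    ((TopCat.Sheaf.isLocallySurjective_iff_epi S.g).2 hS.epi_g) U c x hx
  exact ⟨V, hV, b, hxV, hb⟩

variable [T2Space X]

/-- Lifts near two compact sets can be merged into a lift near their union. -/
lemma exists_lift_union (hA : IsCSoft S.X₁) {U U₁ U₂ : Opens X} (c : S.X₃.obj.obj (op U))
    {L₁ L₂ : Set X} (hL₁ : IsCompact L₁) (hL₂ : IsCompact L₂) (h₁ : U₁ ≤ U) (h₂ : U₂ ≤ U)
    (hLU₁ : L₁ ⊆ U₁) (hLU₂ : L₂ ⊆ U₂) (b₁ : S.X₂.obj.obj (op U₁)) (b₂ : S.X₂.obj.obj (op U₂))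
    (hb₁ : S.g.hom.app (op U₁) b₁ = res S.X₃.obj h₁ c)
    (hb₂ : S.g.hom.app (op U₂) b₂ = res S.X₃.obj h₂ c) :
    ∃ (V : Opens X) (hV : V ≤ U) (b : S.X₂.obj.obj (op V)), L₁ ∪ L₂ ⊆ V ∧
      S.g.hom.app (op V) b = res S.X₃.obj hV c := by
  -- The two lifts differ on the overlap by a section of the kernel. C-softness replaces it near `L₁
  -- ∩ L₂` by a global section, which can then correct `b₂` on all of `U₂`.
  obtain ⟨a₀, ha₀⟩ := exists_preimage_of_g_app_eq_zero hS (U := U₁ ⊓ U₂)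
    (b := res S.X₂.obj inf_le_left b₁ - res S.X₂.obj inf_le_right b₂) (by
      rw [map_sub, app_res, app_res, hb₁, hb₂, res_res, res_res, sub_self])
  obtain ⟨a, -, N, hN, hLN, ha⟩ := hA (hL₁.inter hL₂)
    (U := U₁ ⊓ U₂) (fun x hx => ⟨hLU₁ hx.1, hLU₂ hx.2⟩) a₀
  -- The lifts agree only on `N`. Off `N` the two compact sets are disjoint, so separating them
  -- shrinks the domains until their overlap lies in `N`.
  obtain ⟨O₁, O₂, hO₁, hO₂, hLO₁, hLO₂, hO⟩ := SeparatedNhds.of_isCompact_isCompact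
    (hL₁.diff N.isOpen) (hL₂.diff N.isOpen) (Set.disjoint_left.2 fun x hx hx' =>
      hx.2 (hLN ⟨hx.1, hx'.1⟩))
  let V₁ : Opens X := U₁ ⊓ (N ⊔ ⟨O₁, hO₁⟩)
  let V₂ : Opens X := U₂ ⊓ (N ⊔ ⟨O₂, hO₂⟩)
  have hVN : V₁ ⊓ V₂ ≤ N := by
    rintro x ⟨⟨-, hx | hx⟩, ⟨-, hx' | hx'⟩⟩
    · exact hx
    · exact hx
    · exact hx'
    · exact (Set.disjoint_left.1 hO hx hx').elim
  let b₂' := b₂ + S.f.hom.app (op U₂) (res S.X₁.obj le_top a)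
  have hb₂' : S.g.hom.app (op U₂) b₂' = res S.X₃.obj h₂ c := by
    rw [map_add, g_app_f_app, hb₂, add_zero]
  have key : res S.X₂.obj (hN.trans inf_le_left) b₁ = res S.X₂.obj (hN.trans inf_le_right) b₂' := by
    have h := congrArg (res S.X₂.obj hN) ha₀
    rw [← app_res, ← ha, map_sub, res_res, res_res] at h
    rw [map_add, ← app_res, res_res, h]
    abel
  obtain ⟨b, hbV₁, hbV₂⟩ := exists_glue (U := V₁) (V := V₂) (W := V₁ ⊔ V₂) le_sup_left le_sup_right
    le_rfl (res S.X₂.obj inf_le_left b₁) (res S.X₂.obj inf_le_left b₂') (by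
      have h := congrArg (res S.X₂.obj hVN) key
      rw [res_res, res_res] at h ⊢
      exact h)
  refine ⟨V₁ ⊔ V₂, sup_le (inf_le_left.trans h₁) (inf_le_left.trans h₂), b, ?_, ?_⟩
  · rintro x (hx | hx)
    · refine Or.inl ⟨hLU₁ hx, ?_⟩
      by_cases hxN : x ∈ N
      · exact Or.inl hxN
      · exact Or.inr (hLO₁ ⟨hx, hxN⟩)
    · refine Or.inr ⟨hLU₂ hx, ?_⟩
      by_cases hxN : x ∈ N
      · exact Or.inl hxN
      · exact Or.inr (hLO₂ ⟨hx, hxN⟩)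
  · refine eq_of_res_eq le_sup_left le_sup_right le_rfl ?_ ?_
    · rw [← app_res, hbV₁, app_res, hb₁, res_res, res_res]
    · rw [← app_res, hbV₂, app_res, hb₂', res_res, res_res]

variable [LocallyCompactSpace X]

/-- If `0 → A → B → C → 0` is exact with `A` c-soft, sections of `C` lift near compact sets. -/
lemma exists_lift_near_isCompact (hA : IsCSoft S.X₁) {K : Set X} {U : Opens X} (hK : IsCompact K)
    (hKU : K ⊆ U) (c : S.X₃.obj.obj (op U)) :
    ∃ (V : Opens X) (hV : V ≤ U) (b : S.X₂.obj.obj (op V)), K ⊆ V ∧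
      S.g.hom.app (op V) b = res S.X₃.obj hV c := by
  -- The compact `L` is part of the predicate because merging lifts needs compact sets, while the
  -- induction runs over arbitrary subsets.
  let P : Set X → Prop := fun s => ∃ L, IsCompact L ∧ s ⊆ L ∧
    ∃ (V : Opens X) (hV : V ≤ U) (b : S.X₂.obj.obj (op V)), L ⊆ V ∧
      S.g.hom.app (op V) b = res S.X₃.obj hV c
  suffices h : P K by
    obtain ⟨L, -, hKL, V, hV, b, hLV, hb⟩ := h
    exact ⟨V, hV, b, hKL.trans hLV, hb⟩
  refine hK.induction_on ?_ ?_ ?_ ?_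
  · refine ⟨∅, isCompact_empty, subset_rfl, ⊥, bot_le, 0, Set.empty_subset _, ?_⟩
    rw [map_zero]
    exact (res_eq_zero_of_disjoint bot_le fun x hx => hx.elim).symm
  · rintro s t hst ⟨L, hL, htL, h⟩
    exact ⟨L, hL, hst.trans htL, h⟩
  · rintro s t ⟨L₁, hL₁, hs, V₁, hV₁, b₁, hLV₁, hb₁⟩ ⟨L₂, hL₂, ht, V₂, hV₂, b₂, hLV₂, hb₂⟩
    exact ⟨L₁ ∪ L₂, hL₁.union hL₂, Set.union_subset_union hs ht,
      exists_lift_union hS hA c hL₁ hL₂ hV₁ hV₂ hLV₁ hLV₂ b₁ b₂ hb₁ hb₂⟩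
  · intro x hx
    obtain ⟨V, hV, b, hxV, hb⟩ := exists_local_lift hS c (hKU hx)
    obtain ⟨L, hL, hxL, hLV⟩ := exists_compact_subset V.isOpen hxV
    exact ⟨L, mem_nhdsWithin_of_mem_nhds (mem_interior_iff_mem_nhds.1 hxL), L, hL, subset_rfl,
      V, hV, b, hLV, hb⟩

/-- Lift the section to `S.X₂` near `K`, extend the lift by c-softness there, and push it down:
supports only shrink. -/
lemma IsCSoft.of_shortExact (hA : IsCSoft S.X₁) (hB : IsCSoft S.X₂) : IsCSoft S.X₃ := by
  intro K U hK hKU c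
  obtain ⟨V, hV, b, hKV, hb⟩ := exists_lift_near_isCompact hS hA hK hKU c
  obtain ⟨t, ht, W, hW, hKW, h⟩ := hB hK hKV b
  refine ⟨S.g.hom.app (op ⊤) t, isCompact_supp_of_subset ht (supp_map S.g.hom t), W, hW.trans hV,
    hKW, ?_⟩
  rw [← app_res, h, app_res, hb, res_res]

/-- If `0 → A → B → C → 0` is exact with `A` c-soft, sections of `C` with compact support lift to
sections of `B` with compact support. -/
lemma gammaC_map_g_surjective (hA : IsCSoft S.X₁) :
    Function.Surjective ((gammaC X).map S.g) := by
  rintro ⟨c, hc⟩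
  replace hc : IsCompact (supp S.X₃.obj c) := hc
  obtain ⟨U, _, b, hKU, hb⟩ := exists_lift_near_isCompact hS hA (U := ⊤) hc (fun x _ => trivial) c
  obtain ⟨L, hL, hKL, hLU⟩ := exists_compact_between hc U.isOpen hKU
  let W : Opens X := ⟨interior L, isOpen_interior⟩
  have hWL : (W : Set X) ⊆ L := interior_subset
  -- Off the support of `c` the lift `b` comes from the kernel.
  let U' : Opens X := ⟨U \ supp S.X₃.obj c, U.isOpen.sdiff hc.isClosed⟩
  have hU' : U' ≤ U := fun x hx => hx.1
  obtain ⟨a₀, ha₀⟩ := exists_preimage_of_g_app_eq_zero hS (U := U') (b := res S.X₂.obj hU' b) (by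
    rw [app_res, hb, res_res]
    exact res_eq_zero_of_disjoint _ fun x hx => hx.2)
  -- `L \ W` is a compact collar avoiding the support of `c`. Subtracting a global extension of `a₀`
  -- makes the lift vanish near the collar, so it can be extended by zero outside `L`.
  obtain ⟨a, -, N, hN, hDN, ha⟩ := hA (hL.diff W.isOpen) (U := U')
    (fun x hx => ⟨hLU hx.1, fun h => hx.2 (hKL h)⟩) a₀
  let b' := b - S.f.hom.app (op U) (res S.X₁.obj le_top a)
  have hb' : S.g.hom.app (op U) b' = res S.X₃.obj le_top c := by
    rw [map_sub, g_app_f_app, hb, sub_zero]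
  have hb'N : res S.X₂.obj (hN.trans hU') b' = 0 := by
    have h := congrArg (res S.X₂.obj hN) ha₀
    rw [← app_res, ← ha, res_res] at h
    rw [map_sub, ← app_res, res_res, h, sub_self]
  let V : Opens X := N ⊔ ⟨Lᶜ, hL.isClosed.isOpen_compl⟩
  have hWV : W ⊓ V ≤ N := by
    rintro x ⟨hx, hx' | hx'⟩
    · exact hx'
    · exact (hx' (hWL hx)).elim
  have hcover : (⊤ : Opens X) ≤ W ⊔ V := by
    intro x _
    by_cases hxL : x ∈ L
    · by_cases hxW : x ∈ W
      · exact Or.inl hxW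
      · exact Or.inr (Or.inl (hDN ⟨hxL, hxW⟩))
    · exact Or.inr (Or.inr hxL)
  obtain ⟨r, hrW, hrV⟩ := exists_glue (U := W) (V := V) (W := ⊤) le_top le_top hcover
    (res S.X₂.obj (fun x hx => hLU (hWL hx)) b') 0 (by
      have h := congrArg (res S.X₂.obj hWV) hb'N
      rw [res_res, map_zero] at h
      rw [res_res, map_zero, h])
  have hr : IsCompact (supp S.X₂.obj r) := isCompact_supp_of_subset hL fun x hx => by
    by_contra hxL
    exact notMem_supp_of_res_eq_zero le_top hrV (Or.inr hxL) hx
  refine ⟨⟨r, hr⟩, Subtype.ext ?_⟩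
  change S.g.hom.app (op ⊤) r = c
  refine eq_of_res_eq (U := W) (V := V) le_top le_top hcover ?_ ?_
  · rw [← app_res, hrW, app_res, hb', res_res]
  · rw [← app_res, hrV, map_zero]
    refine (res_eq_zero_of_disjoint _ ?_).symm
    rintro x (hx | hx) hxc
    · exact (hN hx).2 hxc
    · exact hx (hWL (hKL hxc))

end ShortExact

section LeftExact

variable {A B : TopCat.Sheaf AddCommGrpCat.{u} X}

lemma app_injective (f : A ⟶ B) [Mono f] (U : Opens X) :
    Function.Injective (f.hom.app (op U)) := by
  have : Mono f.hom := inferInstanceAs (Mono ((TopCat.Sheaf.forget _ _).map f))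
  exact (AddCommGrpCat.mono_iff_injective _).1 ((NatTrans.mono_iff_mono_app _).1 this (op U))

/-- Where the image vanishes locally, injectivity on sections makes `s` vanish. Hence a preimage of
a compactly supported section is compactly supported, which gives left exactness of `Γ_c`. -/
lemma supp_app_of_mono (f : A ⟶ B) [Mono f] {U : Opens X} (s : A.obj.obj (op U)) :
    supp B.obj (f.hom.app (op U) s) = supp A.obj s := by
  refine (supp_map f.hom s).antisymm fun x hx => ?_
  by_contra h
  obtain ⟨W, hxW, hW⟩ := exists_open_of_notMem_supp _ hx.1 h
  refine notMem_supp_of_res_eq_zero (V := U ⊓ W) inf_le_left (s := s) ?_ ⟨hx.1, hxW⟩ hx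
  apply app_injective f
  rw [app_res, map_zero]
  exact res_eq_zero_of_disjoint _ fun y hy => hW y hy.2

instance (f : A ⟶ B) [Mono f] : Mono ((gammaC X).map f) := by
  rw [AddCommGrpCat.mono_iff_injective]
  intro s t h
  exact Subtype.ext (app_injective f ⊤ (congrArg Subtype.val h))

lemma gammaC_exact {S : ShortComplex (TopCat.Sheaf AddCommGrpCat.{u} X)} (hS : S.Exact)
    [Mono S.f] : (S.map (gammaC X)).Exact := by
  rw [ShortComplex.ab_exact_iff]
  rintro ⟨b, hb⟩ h
  obtain ⟨a, rfl⟩ := TopCat.Sheaf.sections_exact_of_left_exact hS inferInstance b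
    (congrArg Subtype.val h)
  refine ⟨⟨a, ?_⟩, rfl⟩
  change IsCompact _ at hb
  rwa [supp_app_of_mono S.f a] at hb

end LeftExact

end CSoft

/-! ### Properness and compactness -/

lemma ProperOver.isCompact_inter_preimage {A B : Type*} [TopologicalSpace A] [TopologicalSpace B]
    {p : A → B} {S : Set A} {V C : Set B} (h : ProperOver p S V) (hC : IsCompact C) (hCV : C ⊆ V) :
    IsCompact (S ∩ p ⁻¹' C) := by
  obtain ⟨hm, hp⟩ := h
  have hC' : IsCompact (Subtype.val ⁻¹' C : Set V) := by
    rw [Subtype.isCompact_iff, Subtype.image_preimage_coe, Set.inter_eq_right.2 hCV]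
    exact hC
  convert (hp.isCompact_preimage hC').image continuous_subtype_val using 1
  ext x
  constructor
  · rintro ⟨hx, hxC⟩
    exact ⟨⟨x, hx⟩, hxC, rfl⟩
  · rintro ⟨x, hx, rfl⟩
    exact ⟨x.2, hx⟩

lemma properOver_univ_of_isCompact {A B : Type*} [TopologicalSpace A] [TopologicalSpace B]
    [T2Space B] {p : A → B} (hp : Continuous p) {S : Set A} (hS : IsCompact S) :
    ProperOver p S Set.univ := by
  have := isCompact_iff_compactSpace.1 hS
  exact ⟨Set.mapsTo_univ _ _, (hp.restrict _).isProperMap⟩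

/-! ### Injective sheaves are flasque -/

section Flasque

variable {X : TopCat.{u}}

lemma isFlasque_of_injective (I : TopCat.Sheaf AddCommGrpCat.{u} X) [Injective I] :
    I.IsFlasque where
  epi {U V} i := by
    have : Injective (C := CategoryTheory.Sheaf (Opens.grothendieckTopology X) _) I :=
      ‹Injective I›
    -- Injectivity passes along right adjoints whose left adjoints preserve monomorphisms: first to
    -- presheaves of groups (sheafification), then to presheaves of sets (free groups). There a
    -- section over `V` is a map from `yoneda.obj V`, and extending it is factoring through a
    -- monomorphism of representables.
    have h₁ : Injective I.obj := Injective.injective_of_adjoint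
      (sheafificationAdjunction (Opens.grothendieckTopology X) AddCommGrpCat.{u}) I
    have : ((Functor.whiskeringRight (Opens X)ᵒᵖ _ _).obj
        AddCommGrpCat.free.{u}).PreservesMonomorphisms := ⟨fun α _ => by
      have (W : (Opens X)ᵒᵖ) : Mono ((((Functor.whiskeringRight (Opens X)ᵒᵖ _ _).obj
          AddCommGrpCat.free.{u}).map α).app W) :=
        inferInstanceAs (Mono (AddCommGrpCat.free.map (α.app W)))
      exact NatTrans.mono_of_mono_app _⟩
    have h₂ : Injective (((Functor.whiskeringRight (Opens X)ᵒᵖ _ _).obj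
        (forget AddCommGrpCat.{u})).obj I.obj) :=
      Injective.injective_of_adjoint (AddCommGrpCat.adj.whiskerRight (Opens X)ᵒᵖ) I.obj
    rw [AddCommGrpCat.epi_iff_surjective]
    intro s
    let s' : yoneda.obj V.unop ⟶ ((Functor.whiskeringRight (Opens X)ᵒᵖ _ _).obj
      (forget AddCommGrpCat.{u})).obj I.obj := yonedaEquiv.symm s
    have : Mono i.unop := ⟨fun _ _ _ => Subsingleton.elim _ _⟩
    refine ⟨yonedaEquiv (Injective.factorThru s' (yoneda.map i.unop)), ?_⟩
    have h := congrArg yonedaEquiv (Injective.comp_factorThru s' (yoneda.map i.unop))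
    rw [← yonedaEquiv_naturality, Equiv.apply_symm_apply] at h
    exact h

end Flasque

/-! ### Sections and c-softness of `f_! F` -/

section LowerShriek

variable {X Y : TopCat.{u}} (f : X ⟶ Y)

section Support

variable {F : TopCat.Sheaf AddCommGrpCat.{u} X}

lemma shriek_res_val {V W : Opens Y} (h : W ≤ V) (s : ((lowerShriek f).obj F).obj.obj (op V)) :
    (res ((lowerShriek f).obj F).obj h s).1 =
      res F.obj (show (Opens.map f).obj W ≤ (Opens.map f).obj V from fun _ hx => h hx) s.1 :=
  rfl

lemma image_supp_subset_supp_shriek {V : Opens Y} (s : ((lowerShriek f).obj F).obj.obj (op V)) :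
    f '' supp F.obj s.1 ⊆ supp ((lowerShriek f).obj F).obj s := by
  rintro _ ⟨x, hx, rfl⟩
  by_contra h
  obtain ⟨W, hxW, hW⟩ := exists_open_of_notMem_supp s (supp_subset s.1 hx) h
  have h0 := res_eq_zero_of_disjoint (s := s) (V := V ⊓ W) inf_le_left fun y hy => hW y hy.2
  exact notMem_supp_of_res_eq_zero (V := (Opens.map f).obj (V ⊓ W)) (fun y hy => hy.1)
    (congrArg Subtype.val h0) ⟨supp_subset s.1 hx, hxW⟩ hx

lemma supp_shriek_subset {V : Opens Y} (s : ((lowerShriek f).obj F).obj.obj (op V)) {C : Set Y}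
    (hC : IsClosed C) (h : f '' supp F.obj s.1 ⊆ C) :
    supp ((lowerShriek f).obj F).obj s ⊆ C := by
  intro y hy
  by_contra hyC
  refine notMem_supp_of_res_eq_zero (V := V ⊓ ⟨Cᶜ, hC.isOpen_compl⟩) inf_le_left (s := s) ?_
    ⟨hy.1, hyC⟩ hy
  refine Subtype.ext ?_
  rw [shriek_res_val]
  exact res_eq_zero_of_disjoint _ fun x hx hxs => hx.2 (h ⟨x, hxs, rfl⟩)

/-- Sections of `F` with compact support are sections of `f_! F` with compact support. -/
lemma isCompact_supp_shriek [T2Space Y] (s : ((lowerShriek f).obj F).obj.obj (op ⊤))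
    (hs : IsCompact (supp F.obj s.1)) : IsCompact (supp ((lowerShriek f).obj F).obj s) := by
  have h := hs.image f.hom.continuous
  exact isCompact_supp_of_subset h (supp_shriek_subset f s h.isClosed subset_rfl)

/-- The support of `s.1` lies over the compact support of `s` and is proper over `Y`, so it is
compact. -/
lemma isCompact_supp_of_isCompact_supp_shriek (s : ((lowerShriek f).obj F).obj.obj (op ⊤))
    (hs : IsCompact (supp ((lowerShriek f).obj F).obj s)) : IsCompact (supp F.obj s.1) := by
  have h := (show ProperOver f (supp F.obj s.1) Set.univ from s.2).isCompact_inter_preimage hs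
    (Set.subset_univ _)
  rwa [Set.inter_eq_left.2] at h
  exact fun x hx => image_supp_subset_supp_shriek f s ⟨x, hx, rfl⟩

/-- Sections with compact support of `f_! F` are sections with compact support of `F`. -/
def lowerShriekCompGammaC [T2Space Y] : lowerShriek f ⋙ gammaC Y ≅ gammaC X :=
  NatIso.ofComponents (fun _ => AddEquiv.toAddCommGrpIso
    { toFun := fun s => ⟨s.1.1, isCompact_supp_of_isCompact_supp_shriek f s.1 s.2⟩
      invFun := fun s => ⟨⟨s.1, properOver_univ_of_isCompact f.hom.continuous s.2⟩,
        isCompact_supp_shriek f ⟨s.1, _⟩ s.2⟩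
      left_inv := fun _ => rfl
      right_inv := fun _ => rfl
      map_add' := fun _ _ => rfl }) fun _ => rfl

end Support

/-- A section of a flasque sheaf whose support is proper over a neighbourhood of a compact set `K`
agrees, near the preimage of `K`, with a global section of compact support. -/
lemma exists_isCompact_supp_of_properOver [T2Space X] [LocallyCompactSpace Y]
    {F : TopCat.Sheaf AddCommGrpCat.{u} X} (hF : F.IsFlasque) {K : Set Y} (hK : IsCompact K)
    {V : Opens Y} (hKV : K ⊆ V) (s : F.obj.obj (op ((Opens.map f).obj V)))
    (hs : ProperOver f (supp F.obj s) V) :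
    ∃ t : F.obj.obj (op ⊤), IsCompact (supp F.obj t) ∧ ∃ (W : Opens Y) (hW : W ≤ V), K ⊆ W ∧
      res F.obj le_top t =
        res F.obj (show (Opens.map f).obj W ≤ (Opens.map f).obj V from fun _ hx => hW hx) s := by
  obtain ⟨C, hC, hKC, hCV⟩ := exists_compact_between hK V.isOpen hKV
  let W : Opens Y := ⟨interior C, isOpen_interior⟩
  have hWV : W ≤ V := fun y hy => hCV (interior_subset hy)
  have hL : IsCompact (supp F.obj s ∩ f ⁻¹' C) := hs.isCompact_inter_preimage hC hCV
  let U₁ : Opens X := (Opens.map f).obj W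
  let U₂ : Opens X := ⟨_, hL.isClosed.isOpen_compl⟩
  -- Over `W` the support of `s` lies in the compact set `L = supp s ∩ f⁻¹(C)`, so `s` glues with
  -- zero off `L`. A flasque extension then has support inside `L`.
  obtain ⟨r, hr₁, hr₂⟩ := exists_glue (F := F) (U := U₁) (V := U₂) (W := U₁ ⊔ U₂) le_sup_left
    le_sup_right le_rfl (res F.obj (fun x hx => hWV hx) s) 0 (by
      refine (res_res _ _ s).trans (Eq.trans ?_ (map_zero _).symm)
      exact res_eq_zero_of_disjoint _ fun x hx hxs => hx.2 ⟨hxs, interior_subset (s := C) hx.1⟩)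
  have := hF.epi (homOfLE (le_top : U₁ ⊔ U₂ ≤ ⊤)).op
  obtain ⟨t, ht⟩ := (AddCommGrpCat.epi_iff_surjective _).1 this r
  replace ht : res F.obj le_top t = r := ht
  refine ⟨t, isCompact_supp_of_subset hL fun x hx => ?_, W, hWV, hKC, ?_⟩
  · by_contra hxL
    refine notMem_supp_of_res_eq_zero (V := U₂) le_top (s := t) ?_ hxL hx
    rw [← hr₂, ← ht, res_res]
  · rw [← hr₁, ← ht, res_res]

/-- The direct image with compact supports of a flasque sheaf is c-soft. -/
lemma isCSoft_lowerShriek [T2Space X] [LocallyCompactSpace Y] [T2Space Y]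
    {F : TopCat.Sheaf AddCommGrpCat.{u} X} (hF : F.IsFlasque) :
    IsCSoft ((lowerShriek f).obj F) := by
  rintro K V hK hKV ⟨s, hs⟩
  obtain ⟨t, ht, W, hW, hKW, h⟩ := exists_isCompact_supp_of_properOver f hF hK hKV s hs
  exact ⟨⟨t, properOver_univ_of_isCompact f.hom.continuous ht⟩, isCompact_supp_shriek f ⟨t, _⟩ ht,
    W, hW, hKW, Subtype.ext h⟩

end LowerShriek

/-! ### `Γ_c` and the homology of complexes of c-soft sheaves -/

section Complexes

variable {X : TopCat.{u}}

instance : Limits.PreservesFiniteLimits (gammaC X) :=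
  ((Functor.preservesFiniteLimits_tfae (gammaC X)).out 1 3 rfl rfl).1
    fun _ hS => have := hS.2; ⟨gammaC_exact hS.1, inferInstance⟩

/-- The image of `f` is c-soft and its compactly supported global sections lift along `f`. -/
def IsGammaCStrict {A B : TopCat.Sheaf AddCommGrpCat.{u} X} (f : A ⟶ B) : Prop :=
  IsCSoft (Limits.image f) ∧ Function.Surjective ((gammaC X).map (Limits.factorThruImage f))

lemma isGammaCStrict_zero (A B : TopCat.Sheaf AddCommGrpCat.{u} X) :
    IsGammaCStrict (0 : A ⟶ B) := by
  have h : Limits.IsZero (Limits.image (0 : A ⟶ B)) :=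
    (Limits.isZero_zero _).of_iso Limits.imageZero
  refine ⟨IsCSoft.of_isZero h, fun s => ⟨0, ?_⟩⟩
  have := subsingleton_of_isZero h ⊤
  exact Subtype.ext (Subsingleton.elim _ _)

variable [T2Space X] [LocallyCompactSpace X]

/-- `Γ_c` commutes with the homology of a short complex whose incoming map is strict. -/
lemma preservesLeftHomologyOf_gammaC (T : ShortComplex (TopCat.Sheaf AddCommGrpCat.{u} X))
    (hT : IsGammaCStrict T.toCycles) : (gammaC X).PreservesLeftHomologyOf T := by
  let S : ShortComplex (TopCat.Sheaf AddCommGrpCat.{u} X) :=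
    ShortComplex.mk (Limits.image.ι T.toCycles) T.homologyπ (by
      rw [← cancel_epi (Limits.factorThruImage T.toCycles), Limits.image.fac_assoc,
        T.toCycles_comp_homologyπ, Limits.comp_zero])
  have hS : S.ShortExact :=
    { exact := by
        refine ShortComplex.exact_of_g_is_cokernel _ ?_
        exact Limits.isCokernelOfComp _ _ T.homologyIsCokernel S.zero (Limits.image.fac _)
      mono_f := inferInstanceAs (Mono (Limits.image.ι T.toCycles))
      epi_g := inferInstanceAs (Epi T.homologyπ) }
  let R : ShortComplex (TopCat.Sheaf AddCommGrpCat.{u} X) :=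
    ShortComplex.mk T.toCycles T.homologyπ T.toCycles_comp_homologyπ
  -- Left exactness puts a section killed in `H` into `Γ_c` of the image, and strictness lifts it
  -- further to the source.
  have hR : (R.map (gammaC X)).Exact := by
    rw [ShortComplex.ab_exact_iff]
    intro z hz
    have := hS.mono_f
    obtain ⟨b, rfl⟩ := (ShortComplex.ab_exact_iff _).1 (gammaC_exact hS.exact) z hz
    obtain ⟨k, rfl⟩ := hT.2 b
    refine ⟨k, ?_⟩
    change (gammaC X).map T.toCycles k = ((gammaC X).map (Limits.factorThruImage T.toCycles) ≫
      (gammaC X).map (Limits.image.ι T.toCycles)) k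
    rw [← Functor.map_comp, Limits.image.fac]
  -- As the image is c-soft, `Γ_c(Z) → Γ_c(H)` is onto; with `hR`, `Γ_c` preserves the cokernel
  -- defining homology.
  have : Epi (R.map (gammaC X)).g :=
    (AddCommGrpCat.epi_iff_surjective _).2 (gammaC_map_g_surjective (S := S) hS hT.1)
  have : Limits.PreservesColimit (Limits.parallelPair T.leftHomologyData.f' 0) (gammaC X) :=
    Limits.preservesColimit_of_preserves_colimit_cocone T.homologyIsCokernel
      ((Limits.CokernelCofork.isColimitMapCoconeEquiv _ _).symm hR.gIsCokernel)
  have : T.leftHomologyData.IsPreservedBy (gammaC X) := ⟨inferInstance, this⟩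
  exact Functor.PreservesLeftHomologyOf.mk' _ T.leftHomologyData

variable (K : CochainComplex (TopCat.Sheaf AddCommGrpCat.{u} X) ℕ)

/-- Vanishing of `H^i` identifies the cycles `Z^i` with the c-soft image `B^i`; now apply the c-soft
results to `0 → Z^i → K^i → B^(i+1) → 0`. -/
lemma isGammaCStrict_succ {i : ℕ} (hK : IsCSoft (K.X i)) (h0 : Limits.IsZero (K.homology i))
    (hi : IsGammaCStrict (K.sc i).toCycles) :
    IsGammaCStrict (K.sc (i + 1)).toCycles := by
  suffices h : IsGammaCStrict (K.toCycles i (i + 1)) by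
    -- `K.sc (i + 1)` starts at `prev (i + 1)`, which equals `i` only propositionally.
    have key (k : ℕ) (hk : k = (ComplexShape.up ℕ).prev (i + 1))
        (h : IsGammaCStrict (K.toCycles k (i + 1))) : IsGammaCStrict (K.sc (i + 1)).toCycles := by
      subst hk
      exact h
    exact key i (CochainComplex.prev_nat_succ i).symm h
  have : Epi (K.sc i).toCycles :=
    (ShortComplex.exact_iff_epi_toCycles _).1 ((ShortComplex.exact_iff_isZero_homology _).2 h0)
  have : Epi (Limits.image.ι (K.sc i).toCycles) :=
    epi_of_epi_fac (Limits.image.fac (K.sc i).toCycles)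
  have : IsIso (Limits.image.ι (K.sc i).toCycles) := isIso_of_mono_of_epi _
  have hZ : IsCSoft (K.sc i).cycles := hi.1.of_iso (asIso (Limits.image.ι (K.sc i).toCycles))
  have hd : Limits.factorThruImage (K.toCycles i (i + 1)) ≫
      (Limits.image.ι (K.toCycles i (i + 1)) ≫ K.iCycles (i + 1)) = K.d i (i + 1) := by
    rw [Limits.image.fac_assoc, HomologicalComplex.toCycles_i]
  let S : ShortComplex (TopCat.Sheaf AddCommGrpCat.{u} X) :=
    ShortComplex.mk (K.iCycles i) (Limits.factorThruImage (K.toCycles i (i + 1))) (by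
      rw [← cancel_mono (Limits.image.ι (K.toCycles i (i + 1)) ≫ K.iCycles (i + 1)),
        Category.assoc, hd, K.iCycles_d, Limits.zero_comp])
  have hS : S.ShortExact :=
    { exact := by
        refine ShortComplex.exact_of_f_is_kernel _ ?_
        exact Limits.isKernelOfComp _ _ (K.cyclesIsKernel i (i + 1)
          ((ComplexShape.up ℕ).next_eq' rfl))
          S.zero hd
      mono_f := inferInstanceAs (Mono (K.iCycles i))
      epi_g := inferInstanceAs (Epi (Limits.factorThruImage (K.toCycles i (i + 1)))) }
  exact ⟨hZ.of_shortExact hS hK, gammaC_map_g_surjective hS hZ⟩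

lemma isGammaCStrict_toCycles (hK : ∀ i, IsCSoft (K.X i)) {q : ℕ}
    (h0 : ∀ i < q, Limits.IsZero (K.homology i)) {i : ℕ} (hi : i ≤ q) :
    IsGammaCStrict (K.sc i).toCycles := by
  induction i with
  | zero =>
    -- Here `prev 0 = 0` is a default value: no differential enters degree `0`.
    have h : (K.sc 0).toCycles = 0 := K.toCycles_eq_zero (by
      rw [CochainComplex.prev_nat_zero]
      simp)
    rw [h]
    exact isGammaCStrict_zero _ _
  | succ i ih => exact isGammaCStrict_succ K (hK i) (h0 i (by omega)) (ih (by omega))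

/-- `Γ_c` commutes with the cohomology of a complex of c-soft sheaves up to the first degree where
it does not vanish. -/
def homologyMapGammaCIso (hK : ∀ i, IsCSoft (K.X i)) {q : ℕ}
    (h0 : ∀ i < q, Limits.IsZero (K.homology i)) {i : ℕ} (hi : i ≤ q) :
    (((gammaC X).mapHomologicalComplex _).obj K).homology i ≅ (gammaC X).obj (K.homology i) :=
  have := preservesLeftHomologyOf_gammaC (K.sc i) (isGammaCStrict_toCycles K hK h0 hi)
  (K.sc i).mapHomologyIso (gammaC X)

end Complexes

/-! ### The comparison isomorphism -/

section Main

variable {X Y : TopCat.{u}} [T2Space X] [LocallyCompactSpace Y] [T2Space Y] (φ : X ⟶ Y)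
  (F : TopCat.Sheaf AddCommGrpCat.{u} X)

/-- `H^i_c(X, F) ≅ Γ_c(Y, R^i φ_! F)` as long as the lower `R^j φ_! F` vanish. -/
def HcIso {q : ℕ} (h : ∀ i < q, Limits.IsZero ((RShriek φ i).obj F)) {i : ℕ} (hi : i ≤ q) :
    (Hc X i).obj F ≅ (gammaC Y).obj ((RShriek φ i).obj F) :=
  let I := injectiveResolution F
  let K := ((lowerShriek φ).mapHomologicalComplex (ComplexShape.up ℕ)).obj
    (InjectiveResolution.cocomplex I)
  let e (j : ℕ) : (RShriek φ j).obj F ≅ K.homology j := I.isoRightDerivedObj (lowerShriek φ) j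
  I.isoRightDerivedObj (gammaC X) i ≪≫
    (HomologicalComplex.homologyFunctor _ _ i).mapIso
      ((NatIso.mapHomologicalComplex (lowerShriekCompGammaC φ).symm _).app I.cocomplex) ≪≫
    homologyMapGammaCIso K (fun _ => isCSoft_lowerShriek φ (isFlasque_of_injective _))
      (fun j hj => (h j hj).of_iso (e j).symm) hi ≪≫
    (gammaC Y).mapIso (e i).symm

end Main

end CompactSupport

end

theorem mainTheorem10 {X Y : TopCat.{u}} [LocallyCompactSpace X] [T2Space X]
    [LocallyCompactSpace Y] [T2Space Y] (φ : X ⟶ Y) (F : TopCat.Sheaf AddCommGrpCat.{u} X) (q : ℕ)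
    (h : ∀ i < q, Limits.IsZero ((CompactSupport.RShriek φ i).obj F)) :
    (∀ i < q, Limits.IsZero ((CompactSupport.Hc X i).obj F)) ∧
      Nonempty ((CompactSupport.Hc X q).obj F ≅
        (CompactSupport.gammaC Y).obj ((CompactSupport.RShriek φ q).obj F)) :=
  ⟨fun i hi => ((CompactSupport.gammaC Y).map_isZero (h i hi)).of_iso
    (CompactSupport.HcIso φ F h hi.le), ⟨CompactSupport.HcIso φ F h le_rfl⟩⟩
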